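/- Let $K_1,K_2\in C([0,1])$ satisfy $K_1(x)<0<K_2(x)$ for all $x\in[0,1]$, and suppose that their distributional second derivatives on $(0,1)$ belong to $L^2([0,1])$. Let $\alpha\in\mathbb R$ and let $f,\sigma:[0,1]\times\mathbb R\to\mathbb R$, with $f(\cdot,y)$ measurable for every $y$, satisfy: (F1) $f$ and $\sigma$ are bounded and there is $C>0$ with $|f(x,y)-f(x,\hat y)|+|\sigma(x,y)-\sigma(x,\hat y)|\le C|y-\hat y|$ for all $x\in[0,1]$, $y,\hat y\in\mathbb R$; (F2) $\sigma$ is jointly continuous and there is $m>0$ with $|\sigma(x,y)|\ge m$ for all $x,y$; (H) $f(x,0)=0$ for all $x\in[0,1]$, and the constant $c<\alpha$ satisfies $|f(x,y_1)-f(x,y_2)|\le c|y_1-y_2|$ for all $x\in[0,1]$, $y_1,y_2\in\mathbb R$. Let $z\in C([0,1])$ with $K_1\le z\le K_2$, and let $(u,\eta,\xi)$, $u=u^0(z,x,t)$, be a solution of the PDE with two reflecting walls $$\partial_t u=\partial_x^2u-\alpha u+f(x,u)+\eta-\xi,\quad K_1\le u\le K_2,\quad \partial_xu(0,t)=\partial_xu(1,t)=0,\quad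 u(\cdot,0)=z .$$ This means that $u$ is continuous on $[0,1]\times[0,\infty)$ with $K_1(x)\le u(x,t)\le K_2(x)$ and $u(\cdot,0)=z$; that $\eta,\xi$ are (positive) measures on $[0,1]\times[0,\infty)$, finite on $[0,1]\times[0,T]$ for every $T>0$; that for all $t\ge0$ and all $\phi\in C^\infty([0,1])$ with $\phi'(0)=\phi'(1)=0$, $$(u(t),\phi)-\int_0^t(u(s),\phi'')\,ds+\alpha\int_0^t(u(s),\phi)\,ds-\int_0^t\big(f(\cdot,u(s)),\phi\big)\,ds=(z,\phi)+\int_0^t\!\!\int_0^1\phi\,d\eta-\int_0^t\!\!\int_0^1\phi\,d\xi ,$$ where $(\cdot,\cdot)$ is the inner product of $L^2([0,1])$ and $u(t)=u(\cdot,t)$; and that for every $T>0$ $$\int_0^T\!\!\int_0^1(u-K_1)\,d\eta=\int_0^T\!\!\int_0^1(K_2-u)\,d\xi=0 .$$ Then, for all $t\ge0$, $$\|u^0(z,\cdot,t)\|_\infty\le e^{-(\alpha-c)t}\,\|z\|_\infty ,$$ where $\|\cdot\|_\infty$ is the maximum norm on $C([0,1])$. -/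

import Mathlib

open MeasureTheory Set
open scoped ContDiff unitInterval

namespace ReflectedPDE

/-- The distributional second derivative of `K` on the open interval `(0,1)` is a function in
`L²([0,1])`. -/
def SecondDerivInL2 (K : C(I, ℝ)) : Prop :=
  ∃ g : I → ℝ, MemLp g 2 volume ∧
    ∀ ψ : ℝ → ℝ, ContDiff ℝ ∞ ψ → HasCompactSupport ψ → tsupport ψ ⊆ Ioo 0 1 →
      ∫ x : I, K x * iteratedDeriv 2 ψ x = ∫ x : I, g x * ψ x

/-- The standing assumptions on the reflecting walls: they are continuous, strictly separated by
`0`, and their distributional second derivatives are square integrable. -/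
structure Walls (K₁ K₂ : C(I, ℝ)) : Prop where
  lower_neg : ∀ x, K₁ x < 0
  upper_pos : ∀ x, 0 < K₂ x
  lower_deriv : SecondDerivInL2 K₁
  upper_deriv : SecondDerivInL2 K₂

/-- Condition (F1): both coefficients are bounded, and Lipschitz in the second variable uniformly
in the first one. -/
def CondF1 (f sigma : I → ℝ → ℝ) : Prop :=
  (∃ M : ℝ, ∀ x y, |f x y| ≤ M ∧ |sigma x y| ≤ M) ∧
    ∃ C : ℝ, 0 < C ∧ ∀ x y y', |f x y - f x y'| + |sigma x y - sigma x y'| ≤ C * |y - y'|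

/-- Condition (F2): the diffusion coefficient is jointly continuous and non-degenerate. -/
def CondF2 (sigma : I → ℝ → ℝ) : Prop :=
  Continuous (fun p : I × ℝ => sigma p.1 p.2) ∧ ∃ m : ℝ, 0 < m ∧ ∀ x y, m ≤ |sigma x y|

/-- Condition (H), with the constant `c` made explicit. -/
structure CondH (f : I → ℝ → ℝ) (α c : ℝ) : Prop where
  zero : ∀ x, f x 0 = 0
  lt : c < α
  lipschitz : ∀ x y₁ y₂, |f x y₁ - f x y₂| ≤ c * |y₁ - y₂|

/-- The state space: continuous functions on `[0,1]` that lie between the two walls. -/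
def stateSpace (K₁ K₂ : C(I, ℝ)) : Set C(I, ℝ) :=
  {z | ∀ x, K₁ x ≤ z x ∧ z x ≤ K₂ x}

/-- Test functions: smooth functions on `[0,1]` (given as restrictions of smooth functions on `ℝ`)
with vanishing derivative at both end points. -/
def IsTestFunction (φ : ℝ → ℝ) : Prop :=
  ContDiff ℝ ∞ φ ∧ deriv φ 0 = 0 ∧ deriv φ 1 = 0

/-- `(u, η, ξ)` is a solution of the uncontrolled PDE with two reflecting walls
`∂u/∂t = ∂²u/∂x² - α u + f(x,u) + η - ξ`, `K₁ ≤ u ≤ K₂`, with homogeneous Neumann boundary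
conditions, started at `z`.

A continuous function `u` on `[0,1] × [0,∞)` is given as the continuous path `t ↦ u(·,t)` in
`C([0,1])`; the values of `u` and of the measures `η`, `ξ` at negative times play no role. -/
structure IsSolution (K₁ K₂ : C(I, ℝ)) (α : ℝ) (f : I → ℝ → ℝ) (z : C(I, ℝ))
    (u : ℝ → C(I, ℝ)) (η ξ : Measure (I × ℝ)) : Prop where
  continuousOn : ContinuousOn u (Ici 0)
  initial : u 0 = z
  mem_stateSpace : ∀ t, 0 ≤ t → u t ∈ stateSpace K₁ K₂
  lower_finite : ∀ T : ℝ, 0 < T → η (univ ×ˢ Icc 0 T) < ⊤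
  upper_finite : ∀ T : ℝ, 0 < T → ξ (univ ×ˢ Icc 0 T) < ⊤
  weak : ∀ t : ℝ, 0 ≤ t → ∀ φ : ℝ → ℝ, IsTestFunction φ →
    (∫ x : I, u t x * φ x)
        - (∫ s in (0 : ℝ)..t, ∫ x : I, u s x * iteratedDeriv 2 φ x)
        + α * (∫ s in (0 : ℝ)..t, ∫ x : I, u s x * φ x)
        - (∫ s in (0 : ℝ)..t, ∫ x : I, f x (u s x) * φ x)
      = (∫ x : I, z x * φ x)
        + (∫ p in univ ×ˢ Icc 0 t, φ p.1 ∂η)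
        - (∫ p in univ ×ˢ Icc 0 t, φ p.1 ∂ξ)
  lower_contact : ∀ T : ℝ, 0 < T →
    ∫ p in univ ×ˢ Icc 0 T, (u p.2 p.1 - K₁ p.1) ∂η = 0
  upper_contact : ∀ T : ℝ, 0 < T →
    ∫ p in univ ×ˢ Icc 0 T, (K₂ p.1 - u p.2 p.1) ∂ξ = 0

end ReflectedPDE

/-! Where `u > 0` it is strictly above the lower wall, so `η` does not act there; `-ξ` only pushes
down, and `f(x,u) ≤ c u`. Hence `u` is there a weak subsolution of `∂u/∂t = ∂²u/∂x² - (α - c) u`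
(`isPositivitySubsolution`), and a maximum principle gives `u ≤ exp(-(α - c) t) ‖z‖`. Since `-u`
solves the same kind of problem with the walls exchanged, the lower bound follows too.

As `u` is merely continuous, the maximum principle is applied to a mollification in `x`. The kernel
is reflected at both end points, so it satisfies the Neumann condition and is an admissible test
function, and a maximum at an end point behaves like an interior one. Nothing is differentiated in
time: `not_isMaxOn` compares increments over a short interval ending at the maximum. -/

namespace ReflectedPDE

/-! ### Reflected mollifiers -/

/-- The kernel on `[0,1]` obtained from `k` by reflection at both end points, for `k` even and
supported in `(-1,1)`. -/
def reflect (k : ℝ → ℝ) (x y : ℝ) : ℝ := k (x - y) + k (x + y) + k (x + y - 2)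

/-- An even smooth probability density supported in `(-δ,δ)`. -/
structure IsMollifier (k : ℝ → ℝ) (δ : ℝ) : Prop where
  contDiff : ContDiff ℝ ∞ k
  neg : ∀ s, k (-s) = k s
  nonneg : ∀ s, 0 ≤ k s
  supp : ∀ s, δ ≤ |s| → k s = 0
  integral : ∫ s, k s = 1

theorem exists_isMollifier {δ : ℝ} (hδ : 0 < δ) : ∃ k, IsMollifier k δ := by
  let b : ContDiffBump (0 : ℝ) := ⟨δ / 2, δ, by positivity, by linarith⟩
  refine ⟨b.normed volume, ?_, b.normed_neg, b.nonneg_normed, fun s hs => ?_, b.integral_normed⟩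
  · exact b.contDiff_normed
  · have : s ∉ Function.support (b.normed volume) := by
      rw [b.support_normed_eq]
      simpa [b] using hs
    simpa using this

theorem integrable_of_continuous {g : I → ℝ} (hg : Continuous g) : Integrable g :=
  hg.integrable_of_hasCompactSupport (HasCompactSupport.of_compactSpace g)

theorem integral_eq_intervalIntegral (g : ℝ → ℝ) : ∫ x : I, g x = ∫ x in (0 : ℝ)..1, g x := by
  rw [integral_subtype measurableSet_Icc g, integral_Icc_eq_integral_Ioc,
    intervalIntegral.integral_of_le zero_le_one]

/-- Differentiation under the integral sign over `[0,1]`, with continuous partial derivative. -/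
theorem hasDerivAt_integral_of_continuous {F F' : ℝ → I → ℝ}
    (hF : Continuous (Function.uncurry F)) (hF' : Continuous (Function.uncurry F'))
    (h : ∀ x y, HasDerivAt (fun x => F x y) (F' x y) x) (x₀ : ℝ) :
    HasDerivAt (fun x => ∫ y, F x y) (∫ y, F' x₀ y) x₀ := by
  obtain ⟨C, hC⟩ := ((isCompact_closedBall x₀ 1).prod
    (isCompact_univ (X := I))).exists_bound_of_continuousOn hF'.continuousOn
  have hFx : ∀ x, Continuous (F x) := fun x => hF.comp (by fun_prop : Continuous fun y => (x, y))
  have hFx' : ∀ x, Continuous (F' x) := fun x => hF'.comp (by fun_prop : Continuous fun y => (x, y))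
  refine (hasDerivAt_integral_of_dominated_loc_of_deriv_le (μ := (volume : Measure I))
    (bound := fun _ => C) (Metric.closedBall_mem_nhds x₀ one_pos) ?_
    (integrable_of_continuous (hFx x₀)) (hFx' x₀).aestronglyMeasurable ?_
    (integrable_const C) ?_).2
  · exact .of_forall fun x => (hFx x).aestronglyMeasurable
  · exact .of_forall fun y x hx => hC (x, y) ⟨hx, mem_univ y⟩
  · exact .of_forall fun y x _ => h x y

theorem hasDerivAt_reflect {k k' : ℝ → ℝ} (hk : ∀ s, HasDerivAt k (k' s) s) (x y : ℝ) :
    HasDerivAt (fun x => reflect k x y) (reflect k' x y) x := by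
  have h1 := (hk (x - y)).comp x ((hasDerivAt_id x).sub_const y)
  have h2 := (hk (x + y)).comp x ((hasDerivAt_id x).add_const y)
  have h3 := (hk (x + y - 2)).comp x (((hasDerivAt_id x).add_const y).sub_const 2)
  simpa [reflect, Function.comp_def] using (h1.fun_add h2).fun_add h3

theorem continuous_reflect {k : ℝ → ℝ} (hk : Continuous k) :
    Continuous fun p : ℝ × ℝ => reflect k p.1 p.2 := by
  unfold reflect; fun_prop

theorem reflect_comm {k : ℝ → ℝ} (hk : ∀ s, k (-s) = k s) (x y : ℝ) :
    reflect k x y = reflect k y x := by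
  rw [reflect, reflect, ← hk (x - y), neg_sub, add_comm x y]

namespace IsMollifier

variable {k : ℝ → ℝ} {δ : ℝ}

theorem contDiff_deriv (h : IsMollifier k δ) : ContDiff ℝ ∞ (deriv k) :=
  (contDiff_infty_iff_deriv.1 h.contDiff).2

theorem continuous_deriv_deriv (h : IsMollifier k δ) : Continuous (deriv (deriv k)) :=
  (contDiff_infty_iff_deriv.1 h.contDiff_deriv).2.continuous

theorem hasDerivAt (h : IsMollifier k δ) (s : ℝ) : HasDerivAt k (deriv k s) s :=
  ((contDiff_infty_iff_deriv.1 h.contDiff).1 s).hasDerivAt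

theorem hasDerivAt_deriv (h : IsMollifier k δ) (s : ℝ) :
    HasDerivAt (deriv k) (deriv (deriv k) s) s :=
  ((contDiff_infty_iff_deriv.1 h.contDiff_deriv).1 s).hasDerivAt

theorem deriv_neg (h : IsMollifier k δ) (s : ℝ) : deriv k (-s) = -deriv k s := by
  have h1 : deriv (fun s => k (-s)) s = -deriv k (-s) := deriv_comp_neg k s
  rw [funext h.neg] at h1
  linarith

theorem deriv_eq_zero (h : IsMollifier k δ) {s : ℝ} (hs : δ ≤ |s|) : deriv k s = 0 := by
  have : IsLocalMin k s := .of_forall fun r => by rw [h.supp s hs]; exact h.nonneg r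
  exact this.deriv_eq_zero

/-- The direct and the mirrored term cancel because `deriv k` is odd; the image at the far end point
is out of range since `δ ≤ 1`. -/
theorem deriv_reflect_zero (h : IsMollifier k δ) (hδ : δ ≤ 1) {y : ℝ} (hy : y ∈ Icc (0 : ℝ) 1) :
    reflect (deriv k) 0 y = 0 := by
  have h3 : deriv k (0 + y - 2) = 0 := h.deriv_eq_zero (by rw [abs_of_neg] <;> linarith [hy.2])
  rw [reflect, h3, zero_sub, h.deriv_neg, zero_add]
  ring

theorem deriv_reflect_one (h : IsMollifier k δ) (hδ : δ ≤ 1) {y : ℝ} (hy : y ∈ Icc (0 : ℝ) 1) :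
    reflect (deriv k) 1 y = 0 := by
  have h3 : deriv k (1 + y) = 0 := h.deriv_eq_zero (by rw [abs_of_pos] <;> linarith [hy.1])
  rw [reflect, h3, show 1 + y - 2 = -(1 - y) by ring, h.deriv_neg]
  ring

theorem reflect_nonneg (h : IsMollifier k δ) (x y : ℝ) : 0 ≤ reflect k x y :=
  add_nonneg (add_nonneg (h.nonneg _) (h.nonneg _)) (h.nonneg _)

/-- Mirror images of `y` are never closer to `x` than `y` itself. -/
theorem reflect_eq_zero (h : IsMollifier k δ) {x y : ℝ} (hx : x ∈ Icc (0 : ℝ) 1)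
    (hy : y ∈ Icc (0 : ℝ) 1) (hxy : δ ≤ |x - y|) : reflect k x y = 0 := by
  have h2 : |x - y| ≤ |x + y| := by
    rw [abs_of_nonneg (add_nonneg hx.1 hy.1), abs_le]
    constructor <;> linarith [hx.1, hy.1]
  have h3 : |x - y| ≤ |x + y - 2| := by
    rw [abs_of_nonpos (by linarith [hx.2, hy.2] : x + y - 2 ≤ 0), abs_le]
    constructor <;> linarith [hx.2, hy.2]
  rw [reflect, h.supp _ hxy, h.supp _ (hxy.trans h2), h.supp _ (hxy.trans h3)]
  simp

/-- The three terms unfold to integrals of `k` over adjacent intervals, together from `x - 2` to `x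
+ 1`, which cover the support of `k`. -/
theorem integral_reflect (h : IsMollifier k δ) (hδ : δ ≤ 1) {x : ℝ} (hx : x ∈ Icc (0 : ℝ) 1) :
    ∫ y : I, reflect k x y = 1 := by
  have hc := h.contDiff.continuous
  have hi : ∀ a b, IntervalIntegrable k volume a b := fun a b => hc.intervalIntegrable a b
  rw [integral_eq_intervalIntegral (fun y => reflect k x y)]
  simp only [reflect]
  rw [intervalIntegral.integral_add (by apply Continuous.intervalIntegrable; fun_prop)
      (by apply Continuous.intervalIntegrable; fun_prop),
    intervalIntegral.integral_add (by apply Continuous.intervalIntegrable; fun_prop)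
      (by apply Continuous.intervalIntegrable; fun_prop)]
  simp_rw [add_sub_right_comm x _ (2 : ℝ)]
  rw [intervalIntegral.integral_comp_sub_left k x, intervalIntegral.integral_comp_add_left k x,
    intervalIntegral.integral_comp_add_left k (x - 2)]
  have e1 : x - 2 + 1 = x - 1 := by ring
  rw [e1, add_comm, ← add_assoc, sub_zero, add_zero, add_zero,
    intervalIntegral.integral_add_adjacent_intervals (hi _ _) (hi _ _),
    intervalIntegral.integral_add_adjacent_intervals (hi _ _) (hi _ _),
    intervalIntegral.integral_of_le (by linarith)]
  refine Eq.trans ?_ h.integral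
  refine setIntegral_eq_integral_of_forall_compl_eq_zero fun s hs => h.supp s ?_
  by_contra! hlt
  exact hs ⟨by linarith [(abs_lt.1 hlt).1, hx.2], by linarith [(abs_lt.1 hlt).2, hx.1]⟩

theorem isTestFunction (h : IsMollifier k δ) (hδ : δ ≤ 1) {x : ℝ} (hx : x ∈ Icc (0 : ℝ) 1) :
    IsTestFunction (reflect k x) := by
  have e : reflect k x = fun y => reflect k y x := funext (reflect_comm h.neg x)
  refine ⟨?_, ?_, ?_⟩
  · have := h.contDiff
    unfold reflect; fun_prop
  · rw [e, (hasDerivAt_reflect h.hasDerivAt 0 x).deriv, h.deriv_reflect_zero hδ hx]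
  · rw [e, (hasDerivAt_reflect h.hasDerivAt 1 x).deriv, h.deriv_reflect_one hδ hx]

/-- By symmetry of the kernel, two derivatives of the test function in `y` become two derivatives of
the mollification in `x`. -/
theorem iteratedDeriv_reflect (h : IsMollifier k δ) (x y : ℝ) :
    iteratedDeriv 2 (reflect k x) y = reflect (deriv (deriv k)) x y := by
  have e : reflect k x = fun y => reflect k y x := funext (reflect_comm h.neg x)
  have e' : deriv (fun y => reflect k y x) = fun y => reflect (deriv k) y x :=
    funext fun y => (hasDerivAt_reflect h.hasDerivAt y x).deriv
  have hneg : ∀ s, deriv (deriv k) (-s) = deriv (deriv k) s := fun s => by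
    have h1 : deriv (fun s => deriv k (-s)) s = -deriv (deriv k) (-s) := deriv_comp_neg (deriv k) s
    rw [funext h.deriv_neg, deriv.fun_neg] at h1
    linarith
  rw [iteratedDeriv_succ, iteratedDeriv_one, e, e', reflect_comm hneg,
    (hasDerivAt_reflect h.hasDerivAt_deriv y x).deriv]

/-- A reflected mollification is differentiated by differentiating the kernel. -/
theorem hasDerivAt_integral_mul_reflect {k k' : ℝ → ℝ} (hk : ∀ s, HasDerivAt k (k' s) s)
    (hk' : Continuous k') (w : C(I, ℝ)) (x : ℝ) :
    HasDerivAt (fun x => ∫ y : I, w y * reflect k x y) (∫ y : I, w y * reflect k' x y) x := by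
  have hc : Continuous k := continuous_iff_continuousAt.2 fun s => (hk s).continuousAt
  have h1 := continuous_reflect hc
  have h2 := continuous_reflect hk'
  refine hasDerivAt_integral_of_continuous (F := fun x y => w y * reflect k x y)
    (F' := fun x y => w y * reflect k' x y) ?_ ?_
    (fun x y => (hasDerivAt_reflect hk x y).const_mul (w y)) x
  · exact (w.continuous.comp continuous_snd).mul
      (h1.comp (by fun_prop : Continuous fun p : ℝ × I => (p.1, (p.2 : ℝ))))
  · exact (w.continuous.comp continuous_snd).mul
      (h2.comp (by fun_prop : Continuous fun p : ℝ × I => (p.1, (p.2 : ℝ))))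

/-- A reflected mollification has non-positive second derivative where it is maximal over
`[0,1]`, also if this happens at an end point. -/
theorem integral_mul_reflect_deriv_deriv_nonpos (h : IsMollifier k δ) (hδ : δ ≤ 1) (w : C(I, ℝ))
    {x₀ : ℝ} (hx₀ : x₀ ∈ Icc (0 : ℝ) 1)
    (hmax : IsMaxOn (fun x => ∫ y : I, w y * reflect k x y) (Icc 0 1) x₀) :
    ∫ y : I, w y * reflect (deriv (deriv k)) x₀ y ≤ 0 := by
  set v : ℝ → ℝ := fun x => ∫ y : I, w y * reflect k x y
  set v₂ : ℝ := ∫ y : I, w y * reflect (deriv (deriv k)) x₀ y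
  have d1 : ∀ x, HasDerivAt v (∫ y : I, w y * reflect (deriv k) x y) x :=
    hasDerivAt_integral_mul_reflect h.hasDerivAt h.contDiff_deriv.continuous w
  have d2 : HasDerivAt (deriv v) v₂ x₀ := by
    rw [funext fun x => (d1 x).deriv]
    exact hasDerivAt_integral_mul_reflect h.hasDerivAt_deriv h.continuous_deriv_deriv w x₀
  have hd0 : deriv v x₀ = 0 := by
    rcases hx₀.1.eq_or_lt with h0 | h0
    · rw [← h0, (d1 0).deriv]
      simp [h.deriv_reflect_zero hδ (Subtype.prop _)]
    rcases hx₀.2.eq_or_lt with h1 | h1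
    · rw [h1, (d1 1).deriv]
      simp [h.deriv_reflect_one hδ (Subtype.prop _)]
    exact (hmax.isLocalMax (Icc_mem_nhds h0 h1)).deriv_eq_zero
  by_contra! hpos
  -- Half of the supposed positive curvature is removed; `g` still has a local minimum, so `v`
  -- exceeds `v x₀` at all nearby points other than `x₀`.
  let g : ℝ → ℝ := fun x => v x - v₂ / 4 * (x - x₀) ^ 2
  have hg : ∀ x, HasDerivAt g (deriv v x - v₂ / 2 * (x - x₀)) x := fun x => by
    have := (d1 x).differentiableAt.hasDerivAt.sub
      ((((hasDerivAt_id x).sub_const x₀).pow 2).const_mul (v₂ / 4))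
    refine this.congr_deriv ?_
    simp; ring
  have hg2 : HasDerivAt (deriv g) (v₂ / 2) x₀ := by
    rw [funext fun x => (hg x).deriv]
    refine (d2.sub (((hasDerivAt_id x₀).sub_const x₀).const_mul (v₂ / 2))).congr_deriv ?_
    ring
  have hmin : IsLocalMin g x₀ := isLocalMin_of_deriv_deriv_pos (by rw [hg2.deriv]; linarith)
    (by rw [(hg x₀).deriv, hd0]; simp) (hg x₀).continuousAt
  obtain ⟨r, hr, hball⟩ := Metric.eventually_nhds_iff.1 hmin
  -- Moving towards the farther end point keeps the comparison point in `[0,1]`.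
  obtain ⟨x, hx, hne, hdist⟩ : ∃ x ∈ Icc (0 : ℝ) 1, x ≠ x₀ ∧ dist x x₀ < r := by
    have hs : 0 < min (r / 2) (1 / 2) := by positivity
    rcases le_total x₀ (1 / 2) with hle | hle
    · refine ⟨x₀ + min (r / 2) (1 / 2), ⟨by linarith [hx₀.1], ?_⟩, by linarith, ?_⟩
      · linarith [min_le_right (r / 2) (1 / 2)]
      · rw [Real.dist_eq, add_sub_cancel_left, abs_of_pos hs]
        linarith [min_le_left (r / 2) (1 / 2)]
    · refine ⟨x₀ - min (r / 2) (1 / 2), ⟨?_, by linarith [hx₀.2]⟩, by linarith, ?_⟩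
      · linarith [min_le_right (r / 2) (1 / 2)]
      · rw [Real.dist_eq, sub_sub_cancel_left, abs_neg, abs_of_pos hs]
        linarith [min_le_left (r / 2) (1 / 2)]
  have h1 := hball hdist
  have h2 : v x ≤ v x₀ := hmax hx
  have h3 : 0 < v₂ / 4 * (x - x₀) ^ 2 :=
    mul_pos (by linarith) (sq_pos_of_ne_zero (sub_ne_zero.2 hne))
  simp only [g, sub_self] at h1
  linarith

end IsMollifier

/-! ### Positivity subsolutions and the maximum principle -/

/-- `u` is a weak subsolution of `∂u/∂t = ∂²u/∂x² - β u` in the region where `u > 0`: the weak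
inequality is tested with nonnegative functions that are supported in this region. -/
def IsPositivitySubsolution (β : ℝ) (u : ℝ → C(I, ℝ)) : Prop :=
  ∀ s t : ℝ, 0 ≤ s → s ≤ t → ∀ φ : ℝ → ℝ, IsTestFunction φ → (∀ x : I, 0 ≤ φ x) →
    (∀ r ∈ Icc s t, ∀ x : I, φ x ≠ 0 → 0 < u r x) →
    (∫ x : I, u t x * φ x) - (∫ x : I, u s x * φ x)
      ≤ ∫ r in s..t, ((∫ x : I, u r x * iteratedDeriv 2 φ x) - β * ∫ x : I, u r x * φ x)

theorem continuous_integral_mul {X : Type*} [TopologicalSpace X] [FirstCountableTopology X]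
    [LocallyCompactSpace X] {w g : X → I → ℝ}
    (hw : Continuous (Function.uncurry w)) (hg : Continuous (Function.uncurry g)) :
    Continuous fun p => ∫ x : I, w p x * g p x := by
  have := continuous_parametric_integral_of_continuous (μ := (volume : Measure I))
    (f := fun p x => w p x * g p x) (hw.mul hg) isCompact_univ
  simpa using this

theorem continuous_uncurry_path {u : ℝ → C(I, ℝ)} (hu : Continuous u) :
    Continuous fun p : ℝ × I => u p.1 p.2 := by
  fun_prop

theorem abs_integral_mul_reflect_sub_le {k : ℝ → ℝ} {δ ε : ℝ} (h : IsMollifier k δ) (hδ : δ ≤ 1)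
    (w : C(I, ℝ)) (x : I) (hw : ∀ y : I, |(x : ℝ) - y| < δ → |w y - w x| ≤ ε) :
    |(∫ y : I, w y * reflect k x y) - w x| ≤ ε := by
  have hq : Continuous fun y : I => reflect k x y :=
    (continuous_reflect h.contDiff.continuous).comp
      (by fun_prop : Continuous fun y : I => ((x : ℝ), (y : ℝ)))
  have e1 : (∫ y : I, w y * reflect k x y) - w x = ∫ y : I, (w y - w x) * reflect k x y := by
    have : w x = ∫ y : I, w x * reflect k x y := by
      rw [integral_const_mul, h.integral_reflect hδ x.2, mul_one]
    conv_lhs => rw [this]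
    rw [← integral_sub (integrable_of_continuous (by fun_prop))
      (integrable_of_continuous (by fun_prop))]
    simp only [sub_mul]
  have e2 : ∫ y : I, ε * reflect k x y = ε := by
    rw [integral_const_mul, h.integral_reflect hδ x.2, mul_one]
  rw [e1, ← Real.norm_eq_abs]
  refine le_of_le_of_eq (norm_integral_le_of_norm_le (g := fun y : I => ε * reflect k x y)
    (integrable_of_continuous (by fun_prop)) (.of_forall fun y => ?_)) e2
  rw [norm_mul, Real.norm_of_nonneg (h.reflect_nonneg _ _), Real.norm_eq_abs]
  by_cases hy : |(x : ℝ) - y| < δ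
  · exact mul_le_mul_of_nonneg_right (hw y hy) (h.reflect_nonneg _ _)
  · simp [h.reflect_eq_zero x.2 y.2 (not_lt.1 hy)]

/-- A strict differential inequality for the mollification is incompatible with a maximum of its
excess over a decaying exponential. -/
theorem IsPositivitySubsolution.not_isMaxOn {β : ℝ} (hβ : 0 < β) {u : ℝ → C(I, ℝ)}
    (hu : Continuous u) (hsub : IsPositivitySubsolution β u) {k : ℝ → ℝ} {δ ε A : ℝ}
    (hk : IsMollifier k δ) (hδ : δ ≤ 1) (hε : 0 < ε) (hA : 0 ≤ A) {t₀ : ℝ} (ht₀ : 0 < t₀) {x₀ : I}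
    (hpos : ∀ y : I, |(x₀ : ℝ) - y| < δ → ε ≤ u t₀ y)
    (hbig : Real.exp (-β * t₀) * A + ε ≤ ∫ y : I, u t₀ y * reflect k x₀ y)
    (hx : IsMaxOn (fun x : ℝ => ∫ y : I, u t₀ y * reflect k x y) (Icc 0 1) x₀)
    (ht : ∀ s ∈ Icc 0 t₀, (∫ y : I, u s y * reflect k x₀ y) - Real.exp (-β * s) * A
      ≤ (∫ y : I, u t₀ y * reflect k x₀ y) - Real.exp (-β * t₀) * A) : False := by
  have h2 := hk.integral_mul_reflect_deriv_deriv_nonpos hδ (u t₀) x₀.2 hx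
  have hucont := continuous_uncurry_path hu
  have hq : Continuous fun p : ℝ × I => reflect k x₀ p.2 :=
    (continuous_reflect hk.contDiff.continuous).comp
      (by fun_prop : Continuous fun p : ℝ × I => ((x₀ : ℝ), (p.2 : ℝ)))
  have hq2 : Continuous fun p : ℝ × I => reflect (deriv (deriv k)) x₀ p.2 :=
    (continuous_reflect hk.continuous_deriv_deriv).comp
      (by fun_prop : Continuous fun p : ℝ × I => ((x₀ : ℝ), (p.2 : ℝ)))
  set v : ℝ → ℝ := fun r => ∫ y : I, u r y * reflect k x₀ y
  set v₂ : ℝ → ℝ := fun r => ∫ y : I, u r y * reflect (deriv (deriv k)) x₀ y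
  have hv : Continuous v := continuous_integral_mul (w := fun r y => u r y)
    (g := fun _ y => reflect k x₀ y) hucont hq
  have hv₂ : Continuous v₂ := continuous_integral_mul (w := fun r y => u r y)
    (g := fun _ y => reflect (deriv (deriv k)) x₀ y) hucont hq2
  set G : ℝ → ℝ := fun r => Real.exp (-β * r) * A
  have hG : Continuous G := by fun_prop
  have hβε : 0 < β * ε := mul_pos hβ hε
  -- At `t₀` the left side is at most `-β G t₀ - β ε`; half of the margin `β ε` is spent on
  -- continuity here, the other half on the variation of `G`.
  have n1 : ∀ᶠ r in nhds t₀, v₂ r - β * v r < -(β * G t₀) - β * ε / 2 := by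
    refine (hv₂.sub (continuous_const.mul hv)).continuousAt.eventually_lt continuousAt_const ?_
    have : β * (G t₀ + ε) ≤ β * v t₀ := mul_le_mul_of_nonneg_left hbig hβ.le
    have h2' : v₂ t₀ ≤ 0 := h2
    change v₂ t₀ - β * v t₀ < _
    linarith
  have n2 : ∀ᶠ r in nhds t₀, β * G r < β * G t₀ + β * ε / 2 := by
    refine (continuous_const.mul hG).continuousAt.eventually_lt continuousAt_const ?_
    change β * G t₀ < _
    linarith
  -- Keeps `u r` positive on the support of the kernel, so the subsolution inequality may be tested
  -- with it.
  have n3 : ∀ᶠ r in nhds t₀, dist (u r) (u t₀) < ε := Metric.tendsto_nhds.1 hu.continuousAt ε hε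
  obtain ⟨a, ha, hball⟩ := Metric.eventually_nhds_iff.1 ((n1.and n2).and n3)
  set s := t₀ - min (a / 2) t₀
  have hm : 0 < min (a / 2) t₀ := lt_min (by linarith) ht₀
  have hs0 : 0 ≤ s := by linarith [min_le_right (a / 2) t₀]
  have hst : s < t₀ := by linarith
  have hnear : ∀ r ∈ Icc s t₀, dist r t₀ < a := fun r hr => by
    rw [dist_comm, Real.dist_eq, abs_of_nonneg (by linarith [hr.2])]
    linarith [hr.1, min_le_left (a / 2) t₀]
  have key := hsub s t₀ hs0 hst.le (reflect k x₀) (hk.isTestFunction hδ x₀.2)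
    (fun y => hk.reflect_nonneg _ _) (fun r hr y hy => by
      have hy' : |(x₀ : ℝ) - y| < δ := by
        by_contra! hcon
        exact hy (hk.reflect_eq_zero x₀.2 y.2 hcon)
      have h1 := hpos y hy'
      have h3 := (ContinuousMap.dist_apply_le_dist (f := u r) (g := u t₀) y).trans_lt
        (hball (hnear r hr)).2
      rw [Real.dist_eq, abs_lt] at h3
      linarith [h3.1])
  simp only [hk.iteratedDeriv_reflect] at key
  have hint : ∫ r in s..t₀, (v₂ r - β * v r) ≤ ∫ r in s..t₀, (-(β * G t₀) - β * ε / 2) :=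
    intervalIntegral.integral_mono_on hst.le
      ((hv₂.sub (continuous_const.mul hv)).intervalIntegrable _ _)
      (by simp) (fun r hr => (hball (hnear r hr)).1.1.le)
  rw [intervalIntegral.integral_const, smul_eq_mul] at hint
  have hGs : β * G s < β * G t₀ + β * ε / 2 := (hball (hnear s ⟨le_rfl, hst.le⟩)).1.2
  -- The exponential lies above its tangent at `s`, so `G` cannot drop faster than this, whereas `v`
  -- must by `key` and `hint`.
  have hexp : G s - β * (t₀ - s) * G s ≤ G t₀ := by
    have e : G t₀ = G s * Real.exp (-(β * (t₀ - s))) := by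
      simp only [G]
      rw [mul_right_comm, ← Real.exp_add]
      congr 2; ring
    have : 0 ≤ G s := mul_nonneg (Real.exp_nonneg _) hA
    rw [e]
    nlinarith [Real.add_one_le_exp (-(β * (t₀ - s)))]
  have hmx := ht s ⟨hs0, hst.le⟩
  have h5 : (t₀ - s) * (β * G s) < (t₀ - s) * (β * G t₀ + β * ε / 2) :=
    mul_lt_mul_of_pos_left hGs (by linarith)
  have key' : v t₀ - v s ≤ ∫ r in s..t₀, (v₂ r - β * v r) := key
  have hmx' : v s - G s ≤ v t₀ - G t₀ := hmx
  linarith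

/-- Maximum principle: a positivity subsolution decays exponentially. -/
theorem IsPositivitySubsolution.le_exp_mul {β : ℝ} (hβ : 0 < β) {u : ℝ → C(I, ℝ)}
    (hu : Continuous u) (hsub : IsPositivitySubsolution β u) {T : ℝ} (hT : 0 ≤ T) (x : I) :
    u T x ≤ Real.exp (-β * T) * ‖u 0‖ := by
  refine le_of_forall_pos_le_add fun ε' hε' => ?_
  -- An excess of `3 * ε` for `u` leaves more than `ε` for `v`, as mollifying costs `ε / 4`; this
  -- rules out a maximum at time `0` and makes `u` exceed `ε / 4` near the maximum point.
  obtain ⟨ε, hε, rfl⟩ : ∃ ε, 0 < ε ∧ 3 * ε = ε' := ⟨ε' / 3, by positivity, by ring⟩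
  have hucont := continuous_uncurry_path hu
  have huc := ((isCompact_Icc (a := (0 : ℝ)) (b := T)).prod (isCompact_univ (X := I)))
    |>.uniformContinuousOn_of_continuous hucont.continuousOn
  obtain ⟨δ', hδ', hosc'⟩ := Metric.uniformContinuousOn_iff.1 huc (ε / 4) (by positivity)
  set δ := min δ' 1
  have hδ : 0 < δ := lt_min hδ' one_pos
  have hδ1 : δ ≤ 1 := min_le_right _ _
  have hosc : ∀ t ∈ Icc 0 T, ∀ x y : I, |(x : ℝ) - y| < δ → |u t y - u t x| ≤ ε / 4 := by
    intro t ht x y hxy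
    have := hosc' (t, y) ⟨ht, mem_univ _⟩ (t, x) ⟨ht, mem_univ _⟩ (by
      rw [Prod.dist_eq, dist_self, max_eq_right dist_nonneg, dist_comm, Subtype.dist_eq,
        Real.dist_eq]
      exact hxy.trans_le (min_le_left _ _))
    rw [Real.dist_eq] at this
    exact this.le
  obtain ⟨k, hk⟩ := exists_isMollifier hδ
  let v : ℝ × I → ℝ := fun p => ∫ y : I, u p.1 y * reflect k p.2 y
  have hv : Continuous v := continuous_integral_mul (w := fun p : ℝ × I => fun y => u p.1 y)
    (g := fun p : ℝ × I => fun y => reflect k p.2 y)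
    (hucont.comp (by fun_prop : Continuous fun q : (ℝ × I) × I => (q.1.1, q.2)))
    ((continuous_reflect hk.contDiff.continuous).comp
      (by fun_prop : Continuous fun q : (ℝ × I) × I => ((q.1.2 : ℝ), (q.2 : ℝ))))
  have hclose : ∀ t ∈ Icc 0 T, ∀ x : I, |v (t, x) - u t x| ≤ ε / 4 := fun t ht x =>
    abs_integral_mul_reflect_sub_le hk hδ1 (u t) x (hosc t ht x)
  obtain ⟨⟨t₀, x₀⟩, ⟨ht₀, -⟩, hmax⟩ :=
    ((isCompact_Icc (a := (0 : ℝ)) (b := T)).prod (isCompact_univ (X := I))).exists_isMaxOn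
      ⟨(T, x), ⟨⟨hT, le_rfl⟩, mem_univ _⟩⟩
      (f := fun p => v p - Real.exp (-β * p.1) * ‖u 0‖) (by fun_prop)
  have hmax' : ∀ t ∈ Icc 0 T, ∀ x : I, v (t, x) - Real.exp (-β * t) * ‖u 0‖
      ≤ v (t₀, x₀) - Real.exp (-β * t₀) * ‖u 0‖ := fun t ht x =>
    hmax (show (t, x) ∈ Icc 0 T ×ˢ univ from ⟨ht, mem_univ _⟩)
  by_contra! hcon
  have hbig : ε < v (t₀, x₀) - Real.exp (-β * t₀) * ‖u 0‖ := by
    have := hmax' T ⟨hT, le_rfl⟩ x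
    have h1 := (abs_le.1 (hclose T ⟨hT, le_rfl⟩ x)).1
    linarith
  have hc0 := abs_le.1 (hclose t₀ ht₀ x₀)
  have ht₀pos : 0 < t₀ := by
    refine ht₀.1.lt_of_ne fun h0 => ?_
    obtain rfl : 0 = t₀ := h0
    have : u 0 x₀ ≤ ‖u 0‖ := (le_abs_self _).trans ((u 0).norm_coe_le_norm x₀)
    simp only [mul_zero, Real.exp_zero, one_mul] at hbig
    linarith [hc0.2]
  have hnn : 0 ≤ Real.exp (-β * t₀) * ‖u 0‖ := by positivity
  refine hsub.not_isMaxOn hβ hu hk hδ1 (ε := ε / 4) (by positivity) (norm_nonneg (u 0)) ht₀pos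
    (x₀ := x₀) ?_ ?_ ?_ ?_
  · intro y hy
    have := (abs_le.1 (hosc t₀ ht₀ x₀ y hy)).1
    linarith [hc0.2]
  · change _ ≤ v (t₀, x₀)
    linarith
  · intro x hx
    have := hmax' t₀ ht₀ ⟨x, hx⟩
    exact (sub_le_sub_iff_right _).1 this
  · exact fun s hs => hmax' s ⟨hs.1, hs.2.trans ht₀.2⟩ x₀

/-! ### Solutions with reflecting walls -/

namespace IsSolution

variable {K₁ K₂ : C(I, ℝ)} {α c : ℝ} {f : I → ℝ → ℝ} {z : C(I, ℝ)} {u : ℝ → C(I, ℝ)}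
  {η ξ : Measure (I × ℝ)}

/-- Values at negative times may be replaced by the initial value. -/
theorem comp_max (h : IsSolution K₁ K₂ α f z u η ξ) :
    IsSolution K₁ K₂ α f z (fun t => u (max 0 t)) η ξ where
  continuousOn := h.continuousOn.comp (by fun_prop) fun t _ => le_max_left 0 t
  initial := by simpa using h.initial
  mem_stateSpace t _ := h.mem_stateSpace _ (le_max_left 0 t)
  lower_finite := h.lower_finite
  upper_finite := h.upper_finite
  weak t ht φ hφ := by
    have e : ∀ g : C(I, ℝ) → ℝ, ∫ s in (0 : ℝ)..t, g (u (max 0 s)) = ∫ s in (0 : ℝ)..t, g (u s) :=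
      fun g => intervalIntegral.integral_congr fun s hs => by
        rw [uIcc_of_le ht] at hs
        simp only [max_eq_right hs.1]
    rw [e fun w => ∫ x : I, w x * iteratedDeriv 2 φ x, e fun w => ∫ x : I, w x * φ x,
      e fun w => ∫ x : I, f x (w x) * φ x, max_eq_right ht]
    exact h.weak t ht φ hφ
  lower_contact T hT := by
    refine Eq.trans ?_ (h.lower_contact T hT)
    refine setIntegral_congr_fun (MeasurableSet.univ.prod measurableSet_Icc) fun p hp => ?_
    simp only [max_eq_right hp.2.1]
  upper_contact T hT := by
    refine Eq.trans ?_ (h.upper_contact T hT)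
    refine setIntegral_congr_fun (MeasurableSet.univ.prod measurableSet_Icc) fun p hp => ?_
    simp only [max_eq_right hp.2.1]

/-- The negative of a solution is a solution, with the roles of the two walls exchanged. -/
theorem neg (h : IsSolution K₁ K₂ α f z u η ξ) :
    IsSolution (-K₂) (-K₁) α (fun x y => -f x (-y)) (-z) (fun t => -u t) ξ η where
  continuousOn := h.continuousOn.neg
  initial := by rw [h.initial]
  mem_stateSpace t ht x := by
    have := h.mem_stateSpace t ht x
    exact ⟨neg_le_neg this.2, neg_le_neg this.1⟩
  lower_finite := h.upper_finite
  upper_finite := h.lower_finite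
  weak t ht φ hφ := by
    have := h.weak t ht φ hφ
    simp only [ContinuousMap.coe_neg, Pi.neg_apply, neg_neg, neg_mul, integral_neg,
      intervalIntegral.integral_neg]
    linarith
  lower_contact T hT := by
    refine Eq.trans ?_ (h.upper_contact T hT)
    refine integral_congr_ae (.of_forall fun p => ?_)
    simp only [ContinuousMap.coe_neg, Pi.neg_apply]
    ring
  upper_contact T hT := by
    refine Eq.trans ?_ (h.lower_contact T hT)
    refine integral_congr_ae (.of_forall fun p => ?_)
    simp only [ContinuousMap.coe_neg, Pi.neg_apply]
    ring

theorem lower_finite' (h : IsSolution K₁ K₂ α f z u η ξ) {t : ℝ} (ht : 0 ≤ t) :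
    η (univ ×ˢ Icc 0 t) < ⊤ :=
  (measure_mono (prod_mono_right (Icc_subset_Icc_right (by linarith)))).trans_lt
    (h.lower_finite (t + 1) (by linarith))

/-- The lower wall exerts no force in the region where the solution is positive. -/
theorem ae_lower_eq_zero (h : IsSolution K₁ K₂ α f z u η ξ) (hu : Continuous u)
    (hK₁ : ∀ x, K₁ x < 0) {s t : ℝ} (hs : 0 ≤ s) (hst : s ≤ t) {φ : ℝ → ℝ}
    (hpos : ∀ r ∈ Icc s t, ∀ x : I, φ x ≠ 0 → 0 < u r x) :
    ∀ᵐ p ∂η.restrict (univ ×ˢ Icc 0 t), s ≤ p.2 → φ p.1 = 0 := by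
  -- The horizon `t + 1` covers `t = 0`, as the contact condition needs a positive horizon.
  have hm : MeasurableSet ((univ : Set I) ×ˢ Icc (0 : ℝ) (t + 1)) :=
    MeasurableSet.univ.prod measurableSet_Icc
  have hcont : Continuous fun p : I × ℝ => u p.2 p.1 - K₁ p.1 := by fun_prop
  have hint : IntegrableOn (fun p : I × ℝ => u p.2 p.1 - K₁ p.1) (univ ×ˢ Icc 0 (t + 1)) η := by
    obtain ⟨C, hC⟩ := ((isCompact_univ (X := I)).prod
      (isCompact_Icc (a := (0 : ℝ)) (b := t + 1))).exists_bound_of_continuousOn hcont.continuousOn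
    exact Measure.integrableOn_of_bounded (h.lower_finite (t + 1) (by linarith)).ne
      hcont.aestronglyMeasurable ((ae_restrict_iff' hm).2 (.of_forall hC))
  have hnn : 0 ≤ᵐ[η.restrict (univ ×ˢ Icc 0 (t + 1))] fun p : I × ℝ => u p.2 p.1 - K₁ p.1 :=
    (ae_restrict_iff' hm).2
      (.of_forall fun p hp => sub_nonneg.2 (h.mem_stateSpace p.2 hp.2.1 p.1).1)
  have hz := (setIntegral_eq_zero_iff_of_nonneg_ae hnn hint).1 (h.lower_contact (t + 1) (by linarith))
  have hz' := ae_mono (Measure.restrict_mono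
    (prod_mono_right (Icc_subset_Icc_right (by linarith : t ≤ t + 1))) le_rfl) hz
  have hm' : MeasurableSet ((univ : Set I) ×ˢ Icc (0 : ℝ) t) :=
    MeasurableSet.univ.prod measurableSet_Icc
  filter_upwards [hz', ae_restrict_mem hm'] with p hp hpm hsp
  by_contra hne
  have h1 := hpos p.2 ⟨hsp, hpm.2.2⟩ p.1 hne
  have h2 := hK₁ p.1
  simp only [Pi.zero_apply] at hp
  linarith

theorem integrableOn_test {μ : Measure (I × ℝ)} {t : ℝ}
    (hμ : μ (univ ×ˢ Icc 0 t) < ⊤) {φ : ℝ → ℝ} (hφ : Continuous φ) :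
    IntegrableOn (fun p : I × ℝ => φ p.1) (univ ×ˢ Icc 0 t) μ := by
  obtain ⟨C, hC⟩ := (isCompact_univ (X := I)).exists_bound_of_continuousOn
    (f := fun x : I => φ x) (by fun_prop)
  exact Measure.integrableOn_of_bounded hμ.ne
    (by fun_prop : Continuous fun p : I × ℝ => φ p.1).aestronglyMeasurable
    (.of_forall fun p => hC p.1 (mem_univ _))

theorem isPositivitySubsolution (h : IsSolution K₁ K₂ α f z u η ξ) (hu : Continuous u)
    (hK₁ : ∀ x, K₁ x < 0) (hf : ∀ y : ℝ, Measurable fun x : I => f x y)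
    (hbdd : ∃ M : ℝ, ∀ x y, |f x y| ≤ M) (hH : CondH f α c) :
    IsPositivitySubsolution (α - c) u := by
  intro s t hs hst φ hφ hφ0 hpos
  have ht : 0 ≤ t := hs.trans hst
  have hφc : Continuous φ := hφ.1.continuous
  have hφ2 : Continuous (iteratedDeriv 2 φ) :=
    hφ.1.continuous_iteratedDeriv 2 (by norm_cast)
  have hfc : ∀ x, Continuous (f x) := fun x =>
    (LipschitzWith.of_dist_le' (K := c) fun y y' => hH.lipschitz x y y').continuous
  -- Carathéodory: measurable in `x` and continuous in `y` gives joint measurability.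
  have hfm : Measurable fun p : ℝ × I => f p.2 p.1 :=
    measurable_uncurry_of_continuous_of_measurable (u := fun y x => f x y) hfc hf
  obtain ⟨M, hM⟩ := hbdd
  have hfu : ∀ r, Measurable fun x : I => f x (u r x) * φ x := fun r =>
    (hfm.comp ((u r).continuous.measurable.prodMk measurable_id)).mul (by fun_prop)
  have hbound : ∀ r, ∀ x : I, ‖f x (u r x) * φ x‖ ≤ M * |φ x| := fun r x => by
    rw [norm_mul]
    exact mul_le_mul_of_nonneg_right (hM _ _) (norm_nonneg _)
  have hbi : Integrable fun x : I => M * |φ x| := integrable_of_continuous (by fun_prop)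
  set A : ℝ → ℝ := fun r => ∫ x : I, u r x * iteratedDeriv 2 φ x
  set B : ℝ → ℝ := fun r => ∫ x : I, u r x * φ x
  set F : ℝ → ℝ := fun r => ∫ x : I, f x (u r x) * φ x
  have hA : Continuous A := continuous_integral_mul (w := fun r y => u r y)
    (g := fun _ y => iteratedDeriv 2 φ y) (continuous_uncurry_path hu)
    (by unfold Function.uncurry; fun_prop)
  have hB : Continuous B := continuous_integral_mul (w := fun r y => u r y)
    (g := fun _ y => φ y) (continuous_uncurry_path hu) (by unfold Function.uncurry; fun_prop)
  have hF : Continuous F := continuous_of_dominated (fun r => (hfu r).aestronglyMeasurable)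
    (fun r => .of_forall (hbound r)) hbi
    (.of_forall fun x => ((hfc x).comp (by fun_prop)).mul continuous_const)
  have hFB : ∀ r ∈ Icc s t, F r ≤ c * B r := fun r hr => by
    rw [← integral_const_mul]
    refine integral_mono (hbi.mono' (hfu r).aestronglyMeasurable (.of_forall (hbound r)))
      (integrable_of_continuous (by fun_prop)) fun x => ?_
    simp only
    by_cases hx : φ x = 0
    · simp [hx]
    · have hup := hpos r hr x hx
      have := hH.lipschitz x (u r x) 0
      rw [hH.zero, sub_zero, sub_zero, abs_of_pos hup] at this
      rw [← mul_assoc]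
      exact mul_le_mul_of_nonneg_right ((le_abs_self _).trans this) (hφ0 x)
  have hsplit : ∀ {g : ℝ → ℝ}, Continuous g →
      (∫ r in (0 : ℝ)..t, g r) = (∫ r in (0 : ℝ)..s, g r) + ∫ r in s..t, g r := fun hg =>
    (intervalIntegral.integral_add_adjacent_intervals (hg.intervalIntegrable _ _)
      (hg.intervalIntegrable _ _)).symm
  have hsub : (univ : Set I) ×ˢ Icc 0 s ⊆ univ ×ˢ Icc 0 t :=
    prod_mono_right (Icc_subset_Icc_right hst)
  -- Between times `s` and `t`, `η` contributes nothing to the tested equation, and below `ξ` enters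
  -- with a favourable sign.
  have hη : ∫ p in univ ×ˢ Icc 0 t, φ p.1 ∂η = ∫ p in univ ×ˢ Icc 0 s, φ p.1 ∂η := by
    refine setIntegral_eq_of_subset_of_ae_sdiff_eq_zero
      (MeasurableSet.univ.prod measurableSet_Icc).nullMeasurableSet hsub ?_
    have h1 := h.ae_lower_eq_zero hu hK₁ hs hst hpos
    rw [ae_restrict_iff' (MeasurableSet.univ.prod measurableSet_Icc)] at h1
    filter_upwards [h1] with p hp hmem
    refine hp hmem.1 ?_
    by_contra! hlt
    exact hmem.2 ⟨mem_univ _, hmem.1.2.1, hlt.le⟩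
  have hξ : ∫ p in univ ×ˢ Icc 0 s, φ p.1 ∂ξ ≤ ∫ p in univ ×ˢ Icc 0 t, φ p.1 ∂ξ :=
    setIntegral_mono_set (integrableOn_test (h.neg.lower_finite' ht) hφc)
      (.of_forall fun p => hφ0 p.1) hsub.eventuallyLE
  have wt := h.weak t ht φ hφ
  have ws := h.weak s hs φ hφ
  have wt' : B t - (∫ r in (0 : ℝ)..t, A r) + α * (∫ r in (0 : ℝ)..t, B r)
    - (∫ r in (0 : ℝ)..t, F r) = _ := wt
  have ws' : B s - (∫ r in (0 : ℝ)..s, A r) + α * (∫ r in (0 : ℝ)..s, B r)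
    - (∫ r in (0 : ℝ)..s, F r) = _ := ws
  rw [hsplit hA, hsplit hB, hsplit hF, hη] at wt'
  have hFint : ∫ r in s..t, F r ≤ ∫ r in s..t, c * B r :=
    intervalIntegral.integral_mono_on hst (hF.intervalIntegrable _ _)
      ((continuous_const.mul hB).intervalIntegrable _ _) hFB
  rw [intervalIntegral.integral_const_mul] at hFint
  have hcB : Continuous fun r => (α - c) * B r := by fun_prop
  change B t - B s ≤ ∫ r in s..t, (A r - (α - c) * B r)
  rw [intervalIntegral.integral_sub (hA.intervalIntegrable _ _)
    (hcB.intervalIntegrable _ _), intervalIntegral.integral_const_mul]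
  linarith

/-- One-sided exponential bound for solutions of the PDE with two reflecting walls. -/
theorem le_exp_mul (h : IsSolution K₁ K₂ α f z u η ξ)
    (hK₁ : ∀ x, K₁ x < 0) (hf : ∀ y : ℝ, Measurable fun x : I => f x y)
    (hbdd : ∃ M : ℝ, ∀ x y, |f x y| ≤ M) (hH : CondH f α c) {t : ℝ} (ht : 0 ≤ t) (x : I) :
    u t x ≤ Real.exp (-(α - c) * t) * ‖z‖ := by
  -- Freezing the path at negative times gives the continuity on all of `ℝ` that the maximum
  -- principle uses.
  have hcont : Continuous fun t => u (max 0 t) :=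
    h.continuousOn.comp_continuous (by fun_prop) fun t => le_max_left 0 t
  have := (h.comp_max.isPositivitySubsolution hcont hK₁ hf hbdd hH).le_exp_mul
    (sub_pos.2 hH.lt) hcont ht x
  simpa only [max_eq_right ht, max_self, h.initial] using this

end IsSolution

theorem CondH.neg {f : I → ℝ → ℝ} {α c : ℝ} (h : CondH f α c) :
    CondH (fun x y => -f x (-y)) α c where
  zero x := by simp [h.zero]
  lt := h.lt
  lipschitz x y₁ y₂ := by
    simpa only [neg_sub_neg] using h.lipschitz x (-y₂) (-y₁)

end ReflectedPDE

theorem lemma7p1 (K₁ K₂ : C(I, ℝ)) (hK : ReflectedPDE.Walls K₁ K₂)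
    (f sigma : I → ℝ → ℝ) (hf : ∀ y : ℝ, Measurable (fun x : I => f x y))
    (hF1 : ReflectedPDE.CondF1 f sigma) (hF2 : ReflectedPDE.CondF2 sigma)
    (α c : ℝ) (hH : ReflectedPDE.CondH f α c)
    (z : C(I, ℝ)) (hz : z ∈ ReflectedPDE.stateSpace K₁ K₂)
    (u : ℝ → C(I, ℝ)) (η ξ : Measure (I × ℝ))
    (hu : ReflectedPDE.IsSolution K₁ K₂ α f z u η ξ) :
    ∀ t : ℝ, 0 ≤ t → ‖u t‖ ≤ Real.exp (-(α - c) * t) * ‖z‖ := by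
  intro t ht
  obtain ⟨⟨M, hM⟩, -⟩ := hF1
  rw [ContinuousMap.norm_le _ (by positivity)]
  intro x
  refine abs_le'.2 ⟨hu.le_exp_mul hK.lower_neg hf ⟨M, fun x y => (hM x y).1⟩ hH ht x, ?_⟩
  -- For `-u` the lower wall is `-K₂`, negative because `K₂` is positive.
  have := hu.neg.le_exp_mul (fun x => neg_lt_zero.2 (hK.upper_pos x)) (fun y => (hf (-y)).neg)
    ⟨M, fun x y => by rw [abs_neg]; exact (hM x (-y)).1⟩ hH.neg ht x
  simpa only [ContinuousMap.coe_neg, Pi.neg_apply, norm_neg] using this
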